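/- Let $n\ge 1$. The $n$-dimensional balanced hypercube $BH_n$ is the graph with vertex set $\{0,1,2,3\}^n$ in which a vertex $(a_0,a_1,\dots,a_{n-1})$ is adjacent to the vertices $(a_0\pm 1,a_1,\dots,a_{n-1})$ and, for each $1\le i\le n-1$, to the vertices $(a_0\pm1,a_1,\dots,a_{i-1},a_i+(-1)^{a_0},a_{i+1},\dots,a_{n-1})$, all coordinates being taken modulo $4$. For graphs $G$ and $H$, an $H$-structure-cut of $G$ is a set $F$ of pairwise vertex-disjoint connected (not necessarily induced) subgraphs of $G$, each isomorphic to $H$, such that $G-V(F)$ is disconnected or has exactly one vertex, where $V(F)$ is the union of the vertex sets of the members of $F$. The $H$-structure-connectivity $\kappa(G;H)$ is the minimum cardinality of an $H$-structure-cut of $G$. Then for every $n\ge 2$, $$\kappa(BH_n;K_{1,3})=n.$$ (In particular, a $K_{1,3}$-structure-cut of $BH_n$ exists.) -/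

import Mathlib

/-- The `n`-dimensional balanced hypercube `BH_n` (`1 ≤ n`). Its vertices are the `4 ^ n` sequences
`(a_0, …, a_{n-1})` of residues modulo `4`. A neighbour of `a` has inner index `a_0 ± 1`, and either
the same outer indices as `a`, or exactly one outer index `a_i` replaced by `a_i + (-1) ^ a_0`. -/
def balancedHypercube (n : ℕ) [NeZero n] : SimpleGraph (Fin n → ZMod 4) where
  Adj a b :=
    (b 0 = a 0 + 1 ∨ b 0 = a 0 - 1) ∧
      ((∀ j, j ≠ 0 → b j = a j) ∨
        ∃ i, i ≠ 0 ∧ b i = a i + (-1) ^ (a 0).val ∧ ∀ j, j ≠ 0 → j ≠ i → b j = a j)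
  symm := ⟨by
    have key : ∀ x y : ZMod 4, (y = x + 1 ∨ y = x - 1) →
        ∀ s t : ZMod 4, t = s + (-1) ^ x.val → s = t + (-1) ^ y.val := by decide
    have key0 : ∀ x y : ZMod 4, (y = x + 1 ∨ y = x - 1) → (x = y + 1 ∨ x = y - 1) := by decide
    rintro a b ⟨h0, h⟩
    refine ⟨key0 _ _ h0, ?_⟩
    rcases h with h | ⟨i, hi, hbi, h⟩
    · exact Or.inl fun j hj => (h j hj).symm
    · exact Or.inr ⟨i, hi, key _ _ h0 _ _ hbi, fun j hj hji => (h j hj hji).symm⟩⟩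
  loopless := ⟨by
    have key : ∀ x : ZMod 4, ¬ (x = x + 1 ∨ x = x - 1) := by decide
    rintro a ⟨h0, -⟩
    exact key _ h0⟩

/-- The vertex set `V(F)`: the union of the vertex sets of the members of `F`. -/
def subgraphVerts {V : Type*} {G : SimpleGraph V} (F : Set G.Subgraph) : Set V :=
  ⋃ S ∈ F, S.verts

/-- A set `F` of pairwise vertex-disjoint connected subgraphs of `G` is a subgraph-cut if
`G - V(F)` is disconnected or trivial (has exactly one vertex). -/
def IsSubgraphCut {V : Type*} (G : SimpleGraph V) (F : Set G.Subgraph) : Prop :=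
  (∀ S ∈ F, S.Connected) ∧
    F.PairwiseDisjoint SimpleGraph.Subgraph.verts ∧
      (¬ (G.induce (subgraphVerts F)ᶜ).Preconnected ∨ ∃ v, (subgraphVerts F)ᶜ = {v})

/-- An `H`-structure-cut of `G`: a subgraph-cut all of whose members are isomorphic to `H`. -/
def IsStructureCut {V W : Type*} (G : SimpleGraph V) (H : SimpleGraph W)
    (F : Set G.Subgraph) : Prop :=
  IsSubgraphCut G F ∧ ∀ S ∈ F, Nonempty (S.coe ≃g H)

/-- The `H`-structure-connectivity `κ(G; H)`: the minimum cardinality of an `H`-structure-cut of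
`G` (`⊤` if there is no such cut, so a finite value is attained). -/
noncomputable def structureConnectivity {V W : Type*} (G : SimpleGraph V) (H : SimpleGraph W) :
    ℕ∞ :=
  sInf {k : ℕ∞ | ∃ F : Set G.Subgraph, IsStructureCut G H F ∧ F.encard = k}

/-! Put `n = m + 1`. Vertices of `BH_n` with the same outer indices and inner indices of equal
parity are twins, so `BH_n` is the graph of twin classes with each class doubled. The class graph is
`n`-regular and bipartite, and `eq_or_eq_of_adj` says that it has no 4-cycle.

Upper bound: the neighbours of `0` form `n` twin pairs. Disjoint stars, each having one pair among
its leaves, can be chosen to avoid `0` and its twin, which leaves `0` isolated.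

Lower bound: `m` stars have at most `4m` vertices, so they fill at most `2m` classes. Counting shows
that no surviving vertex is isolated (`exists_adj_notMem`) and that no edge of classes is cut off
(`exists_adj_notMem_fullClasses`). By `exists_forall_eq_of_card_le_two_mul`, deleting that few
classes without creating a component of size one or two leaves the class graph connected; the case
`m = 1` is separate. Its proof splits the class graph into four cyclically arranged layers.
Connectedness is phrased as constancy of functions that agree along surviving edges. -/

/-- The classes of vertices of `BH_{m+1}` with equal neighbourhoods: the parity of the inner index
(`true` for even) together with the outer indices. -/
abbrev TwinClass (m : ℕ) : Type := Bool × (Fin m → ZMod 4)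

/-! ### The class graph: layers, degrees, absence of 4-cycles -/

namespace TwinClass

/-- The increment `(-1) ^ a_0` of an outer index, as a function of the parity of `a_0`. -/
def sgn : Bool → ZMod 4
  | true => 1
  | false => -1

/-- Adjacency of twin classes. -/
def Adj {m : ℕ} (u v : TwinClass m) : Prop :=
  v.1 = !u.1 ∧ (v.2 = u.2 ∨ ∃ i, v.2 = u.2 + Pi.single i (sgn u.1))

/-- The class with the other parity and the same outer indices. -/
def flip {m : ℕ} (u : TwinClass m) : TwinClass m := (!u.1, u.2)

/-- The embedding of `TwinClass m` as the `k`-th layer of `TwinClass (m + 1)`. -/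
def layer {m : ℕ} (k : ZMod 4) (u : TwinClass m) : TwinClass (m + 1) := (u.1, Fin.cons k u.2)

lemma flip_flip {m : ℕ} (u : TwinClass m) : u.flip.flip = u := by simp [flip]

lemma sgn_not (b : Bool) : sgn (!b) = -sgn b := by cases b <;> simp [sgn]

lemma Adj.symm {m : ℕ} {u v : TwinClass m} (h : Adj u v) : Adj v u := by
  obtain ⟨h1, h2⟩ := h
  refine ⟨by simp [h1], ?_⟩
  rcases h2 with h2 | ⟨i, h2⟩
  · exact Or.inl h2.symm
  · refine Or.inr ⟨i, ?_⟩
    rw [h2, h1, sgn_not, add_assoc, ← Pi.single_add]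
    simp

lemma adj_flip {m : ℕ} (u : TwinClass m) : Adj u u.flip := ⟨rfl, Or.inl rfl⟩

lemma Adj.ne {m : ℕ} {u v : TwinClass m} (h : Adj u v) : u ≠ v := by
  rintro rfl
  have := h.1
  cases h' : u.1 <;> simp_all

lemma layer_surjective {m : ℕ} (w : TwinClass (m + 1)) : ∃ k u, w = layer k u :=
  ⟨w.2 0, (w.1, Fin.tail w.2), by simp [layer]⟩

lemma layer_inj {m : ℕ} {i j : ZMod 4} {u v : TwinClass m} :
    layer i u = layer j v ↔ i = j ∧ u = v := by
  simp only [layer, Prod.ext_iff, Fin.cons_inj]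
  tauto

/-- Only the first outer index distinguishes layers, so a class has exactly one neighbour off its
layer, in the next or the previous layer according to its parity. -/
lemma adj_layer {m : ℕ} {i j : ZMod 4} {u v : TwinClass m} :
    Adj (layer i u) (layer j v) ↔ (i = j ∧ Adj u v) ∨ (j = i + sgn u.1 ∧ v = u.flip) := by
  obtain ⟨b, x⟩ := u
  obtain ⟨c, y⟩ := v
  have h0 : ∀ s : ZMod 4, (Fin.cons i x + Pi.single 0 s : Fin (m + 1) → ZMod 4) =
      Fin.cons (i + s) x := by
    intro s; ext l; refine Fin.cases ?_ (fun l => ?_) l <;> simp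
  have hs : ∀ (s : ZMod 4) (q : Fin m), (Fin.cons i x + Pi.single q.succ s :
      Fin (m + 1) → ZMod 4) = Fin.cons i (x + Pi.single q s) := by
    intro s q; ext l; refine Fin.cases ?_ (fun l => ?_) l <;> simp [Pi.single_apply]
  simp only [Adj, layer, flip, Fin.exists_fin_succ, h0, hs, Fin.cons_inj, Prod.ext_iff]
  constructor
  · rintro ⟨h, ⟨rfl, rfl⟩ | ⟨rfl, rfl⟩ | ⟨q, rfl, h'⟩⟩ <;> grind
  · rintro (⟨rfl, h, rfl | ⟨q, h'⟩⟩ | ⟨rfl, h, rfl⟩) <;> grind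

lemma layer_adj_layer {m : ℕ} {k : ZMod 4} {u v : TwinClass m} (h : Adj u v) :
    Adj (layer k u) (layer k v) := adj_layer.2 (Or.inl ⟨rfl, h⟩)

lemma layer_adj_flip {m : ℕ} (k : ZMod 4) (u : TwinClass m) :
    Adj (layer k u) (layer (k + sgn u.1) u.flip) := adj_layer.2 (Or.inr ⟨rfl, rfl⟩)

/-- Two distinct classes have at most one common neighbour. -/
lemma eq_or_eq_of_adj {m : ℕ} {x y z w : TwinClass m} (h1 : Adj x y) (h2 : Adj x w)
    (h3 : Adj z y) (h4 : Adj z w) : x = z ∨ y = w := by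
  induction m with
  | zero =>
    left
    have := h1.1
    have := h3.1
    refine Prod.ext (by grind) (Subsingleton.elim _ _)
  | succ m ih =>
    obtain ⟨i, x, rfl⟩ := layer_surjective x
    obtain ⟨j, y, rfl⟩ := layer_surjective y
    obtain ⟨k, z, rfl⟩ := layer_surjective z
    obtain ⟨l, w, rfl⟩ := layer_surjective w
    have hx : x.1 = z.1 := by
      have := h1.1
      have := h3.1
      simp only [layer] at *
      grind
    -- Classes of equal parity leave their layers in the same direction; exchanging two layers this
    -- way would give `2 = 0` modulo `4`.
    have key : ∀ (b : Bool) (i k : ZMod 4), i = k + sgn b → k = i + sgn b → False := by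
      unfold sgn; decide
    have hf : ∀ u v : TwinClass m, u.flip = v.flip → u = v := by
      intro u v h
      rw [← flip_flip u, h, flip_flip]
    rw [adj_layer] at h1 h2 h3 h4
    simp only [layer_inj]
    have key' := key z.1
    rw [hx] at h1 h2
    rcases h1 with ⟨rfl, h1⟩ | ⟨rfl, rfl⟩ <;> rcases h2 with ⟨rfl, h2⟩ | ⟨rfl, rfl⟩ <;>
      rcases h3 with ⟨h3', h3⟩ | ⟨h3', h3⟩ <;> rcases h4 with ⟨h4', h4⟩ | ⟨h4', h4⟩ <;>
      grind

open Classical in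
/-- The neighbours of a class. -/
noncomputable def nbrs {m : ℕ} (u : TwinClass m) : Finset (TwinClass m) :=
  Finset.univ.filter (Adj u)

lemma mem_nbrs {m : ℕ} {u v : TwinClass m} : v ∈ nbrs u ↔ Adj u v := by simp [nbrs]

lemma card_nbrs {m : ℕ} (u : TwinClass m) : (nbrs u).card = m + 1 := by
  classical
  have hs : sgn u.1 ≠ 0 := by cases u.1 <;> decide
  let g : Option (Fin m) → TwinClass m := fun o =>
    (!u.1, u.2 + o.elim 0 fun i => Pi.single i (sgn u.1))
  have hg : Function.Injective g := by
    intro a b h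
    have h' := add_left_cancel (Prod.ext_iff.1 h).2
    rcases a with _ | a <;> rcases b with _ | b
    · rfl
    · exact absurd (by simpa using congrFun h' b) hs.symm
    · exact absurd (by simpa using congrFun h' a) hs
    · have := congrFun h' a
      by_cases hab : a = b
      · rw [hab]
      · simp [hab, hs] at this
  have : nbrs u = Finset.univ.image g := by
    ext v
    simp only [mem_nbrs, Finset.mem_image, Finset.mem_univ, true_and, Adj, g, Option.exists,
      Prod.ext_iff]
    simp only [Option.elim, add_zero]
    grind
  rw [this, Finset.card_image_of_injective _ hg]
  simp

lemma card_inter_nbrs_le {m : ℕ} {u v : TwinClass m} (h : u ≠ v) :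
    (nbrs u ∩ nbrs v).card ≤ 1 := by
  refine Finset.card_le_one.2 fun a ha b hb => ?_
  simp only [Finset.mem_inter, mem_nbrs] at ha hb
  exact (eq_or_eq_of_adj ha.1 hb.1 ha.2 hb.2).resolve_left h

/-! ### Deleted classes layer by layer -/

open Classical in
/-- The trace of a set of classes on the `k`-th layer. -/
noncomputable def slice {m : ℕ} (D : Finset (TwinClass (m + 1))) (k : ZMod 4) :
    Finset (TwinClass m) := Finset.univ.filter fun u => layer k u ∈ D

lemma mem_slice {m : ℕ} {D : Finset (TwinClass (m + 1))} {k : ZMod 4} {u : TwinClass m} :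
    u ∈ slice D k ↔ layer k u ∈ D := by simp [slice]

/-- The layers partition the classes; starting at an arbitrary `k` lets a heavily damaged layer
serve as origin. -/
lemma card_eq_slices {m : ℕ} (D : Finset (TwinClass (m + 1))) (k : ZMod 4) :
    D.card = (slice D k).card + (slice D (k + 1)).card + (slice D (k + 2)).card +
      (slice D (k + 3)).card := by
  classical
  have h1 : D.card = ∑ j : ZMod 4, (slice D j).card := by
    rw [Finset.card_eq_sum_card_fiberwise (f := fun w => w.2 0) (t := Finset.univ) (by simp)]
    refine Finset.sum_congr rfl fun j _ => ?_
    symm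
    refine Finset.card_bij (fun u _ => layer j u) ?_ ?_ ?_
    · intro u hu
      simpa [mem_slice, layer] using hu
    · intro u _ v _ h
      exact (layer_inj.1 h).2
    · intro w hw
      obtain ⟨i, u, rfl⟩ := layer_surjective w
      simp only [Finset.mem_filter] at hw
      have : i = j := by simpa [layer] using hw.2
      subst this
      exact ⟨u, mem_slice.2 hw.1, rfl⟩
  have h2 : ∀ (F : ZMod 4 → ℕ), ∑ j, F j = F 0 + F 1 + F 2 + F 3 := fun F => Fin.sum_univ_four F
  rw [h1, h2]
  have h3 : ∀ k : ZMod 4, k = 0 ∨ k = 1 ∨ k = 2 ∨ k = 3 := by decide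
  rcases h3 k with rfl | rfl | rfl | rfl
  · simp
  · rw [show (1 + 1 : ZMod 4) = 2 from rfl, show (1 + 2 : ZMod 4) = 3 from rfl,
      show (1 + 3 : ZMod 4) = 0 from rfl]; ring
  · rw [show (2 + 1 : ZMod 4) = 3 from rfl, show (2 + 2 : ZMod 4) = 0 from rfl,
      show (2 + 3 : ZMod 4) = 1 from rfl]; ring
  · rw [show (3 + 1 : ZMod 4) = 0 from rfl, show (3 + 2 : ZMod 4) = 1 from rfl,
      show (3 + 3 : ZMod 4) = 2 from rfl]; ring

/-- `f` takes equal values at adjacent classes outside `D`. -/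
def Compatible {m : ℕ} {β : Type*} (D : Finset (TwinClass m)) (f : TwinClass m → β) : Prop :=
  ∀ u v, Adj u v → u ∉ D → v ∉ D → f u = f v

lemma two_mul_lt_four_pow (m : ℕ) : 2 * m < 4 ^ m := by
  induction m with
  | zero => simp
  | succ m ih => have := Nat.one_le_pow m 4 (by simp); rw [pow_succ]; omega

lemma exists_forall_notMem {m : ℕ} {D E : Finset (TwinClass m)} (h : D.card + E.card < 4 ^ m) :
    ∃ x : Fin m → ZMod 4, ∀ b, (b, x) ∉ D ∧ (b, x) ∉ E := by
  classical
  have : ((D ∪ E).image Prod.snd).card < (Finset.univ : Finset (Fin m → ZMod 4)).card := by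
    rw [Finset.card_univ, Fintype.card_fun, ZMod.card, Fintype.card_fin]
    exact (Finset.card_image_le.trans (Finset.card_union_le _ _)).trans_lt h
  obtain ⟨x, -, hx⟩ := Finset.exists_mem_notMem_of_card_lt_card this
  exact ⟨x, fun b => ⟨fun hb => hx (Finset.mem_image.2 ⟨(b, x), Finset.mem_union_left _ hb, rfl⟩),
    fun hb => hx (Finset.mem_image.2 ⟨(b, x), Finset.mem_union_right _ hb, rfl⟩)⟩⟩

/-- If every compatible function on `TwinClass m` is constant off a set of at most `m` classes,
then a compatible function is constant on each layer with few deleted classes, and its values on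
consecutive layers of this kind agree. -/
lemma exists_layer_values {m : ℕ} {β : Type*} {D : Finset (TwinClass (m + 1))}
    {f : TwinClass (m + 1) → β} (hf : Compatible D f)
    (ih : ∀ (E : Finset (TwinClass m)) (g : TwinClass m → β), E.card ≤ m → Compatible E g →
      ∃ t, ∀ u ∉ E, g u = t) :
    ∃ t : ZMod 4 → β, (∀ k, (slice D k).card ≤ m → ∀ u, layer k u ∉ D → f (layer k u) = t k) ∧
      ∀ k, (slice D k).card ≤ m → (slice D (k + 1)).card ≤ m → t k = t (k + 1) := by
  have h : ∀ k, ∃ t, (slice D k).card ≤ m → ∀ u, layer k u ∉ D → f (layer k u) = t := by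
    intro k
    by_cases hk : (slice D k).card ≤ m
    · obtain ⟨t, ht⟩ := ih (slice D k) (fun u => f (layer k u)) hk fun u v huv hu hv =>
        hf _ _ (layer_adj_layer huv) (by rwa [mem_slice] at hu) (by rwa [mem_slice] at hv)
      exact ⟨t, fun _ u hu => ht u (by rwa [mem_slice])⟩
    -- A dummy value: nothing is claimed about `t k` on a heavily damaged layer.
    · exact ⟨f (layer 0 (true, 0)), fun h => absurd h hk⟩
  choose t ht using h
  refine ⟨t, ht, fun k h0 h1 => ?_⟩
  -- At most `2m < 4 ^ m` outer vectors are blocked, so some edge between the two layers survives.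
  obtain ⟨x, hx⟩ := exists_forall_notMem (D := slice D k) (E := slice D (k + 1))
    (by have := two_mul_lt_four_pow m; omega)
  simp only [mem_slice] at hx
  rw [← ht k h0 (true, x) (hx true).1, ← ht (k + 1) h1 (false, x) (hx false).2]
  exact hf _ _ (layer_adj_flip k (true, x)) (hx true).1 (hx false).2

lemma notMem_of_slice_card_eq_zero {m : ℕ} {D : Finset (TwinClass (m + 1))} {k : ZMod 4}
    (h : (slice D k).card = 0) (u : TwinClass m) : layer k u ∉ D := by
  rw [← mem_slice, Finset.card_eq_zero.1 h]
  simp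

end TwinClass

/-! ### Connectivity of the class graph after deletions -/

namespace TwinClass

lemma eq_add_of_ne {j k : ZMod 4} (h : j ≠ k) : j = k + 1 ∨ j = k + 2 ∨ j = k + 3 := by
  revert j k; decide

lemma sgn_ne_zero (b : Bool) : sgn b ≠ 0 := by cases b <;> decide

lemma add_sgn_ne (k : ZMod 4) (b : Bool) : k + sgn b ≠ k := by simp [sgn_ne_zero]

/-- Removing one layer from the 4-cycle of layers leaves a path, along which the values propagate.
-/
lemma values_eq {β : Type*} {t : ZMod 4 → β} {P : ZMod 4 → Prop}
    (hlink : ∀ k, P k → P (k + 1) → t k = t (k + 1)) {k : ZMod 4} (hP : ∀ j, j ≠ k → P j)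
    (j : ZMod 4) (hj : j ≠ k) : t j = t (k + 1) := by
  have e1 : k + 1 + 1 = k + 2 := by ring
  have e2 : k + 2 + 1 = k + 3 := by ring
  have n1 : k + 1 ≠ k := by clear * - k; decide +revert
  have n2 : k + 2 ≠ k := by clear * - k; decide +revert
  have n3 : k + 3 ≠ k := by clear * - k; decide +revert
  have h1 := hlink (k + 1) (hP _ n1) (by rw [e1]; exact hP _ n2)
  have h2 := hlink (k + 2) (hP _ n2) (by rw [e2]; exact hP _ n3)
  rw [e1] at h1
  rw [e2] at h2
  rcases eq_add_of_ne hj with rfl | rfl | rfl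
  · rfl
  · exact h1.symm
  · rw [h1, h2]

/-- Deleting at most `m` classes leaves the `(m + 1)`-regular graph of classes connected. -/
theorem exists_forall_eq_of_card_le {m : ℕ} {β : Type*} (D : Finset (TwinClass m))
    (f : TwinClass m → β) (hD : D.card ≤ m) (hf : Compatible D f) : ∃ t, ∀ u ∉ D, f u = t := by
  induction m with
  | zero =>
    obtain rfl : D = ∅ := Finset.card_eq_zero.1 (by omega)
    refine ⟨f (true, 0), fun u _ => ?_⟩
    obtain ⟨b, x⟩ := u
    obtain rfl : x = 0 := Subsingleton.elim _ _
    cases b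
    · exact hf _ _ (adj_flip (false, 0)) (by simp) (by simp)
    · rfl
  | succ m ih =>
    obtain ⟨t, ht, hlink⟩ := exists_layer_values hf ih
    by_cases hall : ∀ k, (slice D k).card ≤ m
    · refine ⟨t 1, fun w hw => ?_⟩
      obtain ⟨k, u, rfl⟩ := layer_surjective w
      rw [ht k (hall k) u hw]
      by_cases hk : k = 0
      · subst hk
        exact hlink 0 (hall _) (hall _)
      · exact values_eq hlink (fun j _ => hall j) k hk
    -- A layer with more than `m` deleted classes contains all the deletions, so each of its
    -- surviving classes has an outward neighbour in an undamaged layer.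
    · push Not at hall
      obtain ⟨k, hk⟩ := hall
      have hc := card_eq_slices D k
      have hz : ∀ j, j ≠ k → (slice D j).card = 0 := by
        intro j hj
        rcases eq_add_of_ne hj with rfl | rfl | rfl <;> omega
      have hv := values_eq hlink (k := k) (fun j hj => by rw [hz j hj]; omega)
      refine ⟨t (k + 1), fun w hw => ?_⟩
      obtain ⟨j, u, rfl⟩ := layer_surjective w
      by_cases hj : j = k
      · subst hj
        have hs := add_sgn_ne j u.1
        have ha := notMem_of_slice_card_eq_zero (hz _ hs) u.flip
        rw [hf _ _ (layer_adj_flip j u) hw ha, ht _ (by rw [hz _ hs]; omega) _ ha, hv _ hs]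
      · rw [ht j (by rw [hz j hj]; omega) u hw, hv j hj]

/-- The ends share at most one neighbour, and the neighbours of the middle have the other parity: `2
* (m + 1) - 1 + (m + 1)`. -/
lemma le_card_nbrs_path {m : ℕ} {x y z : TwinClass m} (hxy : Adj x y) (hyz : Adj y z)
    (hxz : x ≠ z) : 3 * m + 2 ≤ (nbrs x ∪ nbrs z ∪ nbrs y).card := by
  rw [Finset.card_union_of_disjoint]
  · have := Finset.card_union_add_card_inter (nbrs x) (nbrs z)
    have := card_inter_nbrs_le hxz
    simp only [card_nbrs] at *
    omega
  · refine Finset.disjoint_left.2 fun w hw hw' => ?_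
    simp only [Finset.mem_union, mem_nbrs] at hw hw'
    have h1 := hxy.1
    have h2 := hyz.1
    have h3 := hw'.1
    rcases hw with hw | hw <;> have h4 := hw.1 <;> grind

/-- Charge each class of `T` to its copy in layer `k` or to that copy's unique neighbour off the
layer; distinct classes get distinct charges. -/
lemma card_le_of_layer_mem_or {m : ℕ} {D : Finset (TwinClass (m + 1))} {T : Finset (TwinClass m)}
    {k : ZMod 4} (h : ∀ w ∈ T, layer k w ∈ D ∨ layer (k + sgn w.1) w.flip ∈ D) :
    T.card ≤ D.card := by
  classical
  refine Finset.card_le_card_of_injOn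
    (fun w => if layer k w ∈ D then layer k w else layer (k + sgn w.1) w.flip) ?_ ?_
  · intro w hw
    simp only
    split_ifs with h'
    · exact h'
    · exact (h w hw).resolve_left h'
  · intro v _ w _ hvw
    simp only at hvw
    split_ifs at hvw
    · exact (layer_inj.1 hvw).2
    · exact absurd (layer_inj.1 hvw).1.symm (add_sgn_ne _ _)
    · exact absurd (layer_inj.1 hvw).1 (add_sgn_ne _ _)
    · rw [← flip_flip v, (layer_inj.1 hvw).2, flip_flip]

/-- A compatible function that is constant outside a layer is constant if there are few deleted
classes and no component has at most two classes. -/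
lemma eq_of_forall_layer_ne {m : ℕ} {β : Type*} (hm : 1 ≤ m) {D : Finset (TwinClass (m + 1))}
    {f : TwinClass (m + 1) → β} (hD : D.card ≤ 2 * (m + 1)) (hf : Compatible D f)
    (hiso : ∀ u ∉ D, ∃ v ∉ D, Adj u v)
    (hedge : ∀ u ∉ D, ∀ v ∉ D, Adj u v → ∃ w ∉ D, Adj u w ∧ w ≠ v ∨ Adj v w ∧ w ≠ u)
    {k : ZMod 4} {t : β} (ht : ∀ j ≠ k, ∀ u, layer j u ∉ D → f (layer j u) = t)
    (u : TwinClass m) (hu : layer k u ∉ D) : f (layer k u) = t := by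
  by_contra hne
  have hout : ∀ w, layer k w ∉ D → f (layer k w) ≠ t → layer (k + sgn w.1) w.flip ∈ D := by
    intro w hw hw'
    by_contra h
    exact hw' ((hf _ _ (layer_adj_flip k w) hw h).trans (ht _ (add_sgn_ne _ _) _ h))
  have hin : ∀ w, layer k w ∉ D → f (layer k w) ≠ t → ∀ v ∉ D, Adj (layer k w) v →
      ∃ v', v = layer k v' ∧ Adj w v' ∧ f (layer k v') ≠ t := by
    intro w hw hw' v hv hwv
    obtain ⟨j, v, rfl⟩ := layer_surjective v
    rcases adj_layer.1 hwv with ⟨rfl, h⟩ | ⟨rfl, rfl⟩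
    · exact ⟨v, rfl, h, by rwa [← hf _ _ hwv hw hv]⟩
    · exact absurd (hout w hw hw') hv
  -- Call a surviving class of layer `k` bad if its value is not `t`. Each in-layer neighbour of a
  -- bad path is deleted or is bad with its outward neighbour deleted. This needs `3m + 2`
  -- deletions, more than `2 * (m + 1)` since `m ≥ 1`.
  have hpath : ∀ x y z, layer k x ∉ D → layer k y ∉ D → layer k z ∉ D → f (layer k x) ≠ t →
      f (layer k y) ≠ t → f (layer k z) ≠ t → Adj x y → Adj y z → x ≠ z → False := by
    intro x y z hx hy hz hx' hy' hz' hxy hyz hxz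
    have h1 := le_card_nbrs_path hxy hyz hxz
    have h2 : (nbrs x ∪ nbrs z ∪ nbrs y).card ≤ D.card := by
      refine card_le_of_layer_mem_or (k := k) fun w hw => ?_
      have : ∃ s, layer k s ∉ D ∧ f (layer k s) ≠ t ∧ Adj s w := by
        simp only [Finset.mem_union, mem_nbrs] at hw
        rcases hw with (hw | hw) | hw
        exacts [⟨x, hx, hx', hw⟩, ⟨z, hz, hz', hw⟩, ⟨y, hy, hy', hw⟩]
      obtain ⟨s, hs, hs', hsw⟩ := this
      by_cases hw : layer k w ∈ D
      · exact Or.inl hw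
      · refine Or.inr (hout w hw ?_)
        rwa [← hf _ _ (layer_adj_layer hsw) hs hw]
    omega
  obtain ⟨v, hv, huv⟩ := hiso _ hu
  obtain ⟨v, rfl, huv', hv'⟩ := hin u hu hne v hv huv
  obtain ⟨w, hw, ⟨h, hwne⟩ | ⟨h, hwne⟩⟩ := hedge _ hu _ hv huv
  · obtain ⟨w, rfl, hw', hwt⟩ := hin u hu hne w hw h
    exact hpath w u v hw hu hv hwt hne hv' hw'.symm huv' fun e => hwne (by rw [e])
  · obtain ⟨w, rfl, hw', hwt⟩ := hin v hv hv' w hw h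
    exact hpath w v u hw hv hu hwt hv' hne hw'.symm huv'.symm fun e => hwne (by rw [e])

/-- The case of two consecutive layers with many deleted classes. -/
lemma eq_of_forall_layer_ne_ne {m : ℕ} {β : Type*} {D : Finset (TwinClass (m + 1))}
    {f : TwinClass (m + 1) → β} (hf : Compatible D f)
    (hiso : ∀ u ∉ D, ∃ v ∉ D, Adj u v)
    (hedge : ∀ u ∉ D, ∀ v ∉ D, Adj u v → ∃ w ∉ D, Adj u w ∧ w ≠ v ∨ Adj v w ∧ w ≠ u)
    {k : ZMod 4} {t : β} (hD : ∀ j, j ≠ k → j ≠ k + 1 → ∀ u, layer j u ∉ D)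
    (ht : ∀ j, j ≠ k → j ≠ k + 1 → ∀ u, f (layer j u) = t)
    (w : TwinClass (m + 1)) (hw : w ∉ D) : f w = t := by
  have a1 : k - 1 ≠ k := by clear * - k; decide +revert
  have a2 : k - 1 ≠ k + 1 := by clear * - k; decide +revert
  have a3 : k + 1 + 1 ≠ k := by clear * - k; decide +revert
  have a4 : k + 1 + 1 ≠ k + 1 := by clear * - k; decide +revert
  -- Half of each damaged layer points to an undamaged layer and so has value `t`. A bad class lies
  -- in the other half, its surviving in-layer neighbours have value `t`, and only its partner in
  -- the other damaged layer can be bad with it: a component of size at most two.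
  have hfalse : ∀ u : TwinClass m, u.1 = false → layer k u ∉ D → f (layer k u) = t := by
    intro u h hu
    have := layer_adj_flip k u
    rw [h, sgn, ← sub_eq_add_neg] at this
    rw [hf _ _ this hu (hD _ a1 a2 _), ht _ a1 a2]
  have htrue : ∀ u : TwinClass m, u.1 = true → layer (k + 1) u ∉ D →
      f (layer (k + 1) u) = t := by
    intro u h hu
    have := layer_adj_flip (k + 1) u
    rw [h, sgn] at this
    rw [hf _ _ this hu (hD _ a3 a4 _), ht _ a3 a4]
  have hk : ∀ u : TwinClass m, u.1 = true → layer k u ∉ D → f (layer k u) ≠ t →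
      ∀ v ∉ D, Adj (layer k u) v → v = layer (k + 1) u.flip := by
    intro u h hu hut v hv huv
    obtain ⟨j, v, rfl⟩ := layer_surjective v
    rcases adj_layer.1 huv with ⟨rfl, h'⟩ | ⟨rfl, rfl⟩
    · refine absurd ?_ hut
      rw [hf _ _ huv hu hv, hfalse _ (by simp [h'.1, h]) hv]
    · rw [h]; rfl
  have hk1 : ∀ u : TwinClass m, u.1 = false → layer (k + 1) u ∉ D → f (layer (k + 1) u) ≠ t →
      ∀ v ∉ D, Adj (layer (k + 1) u) v → v = layer k u.flip := by
    intro u h hu hut v hv huv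
    obtain ⟨j, v, rfl⟩ := layer_surjective v
    rcases adj_layer.1 huv with ⟨rfl, h'⟩ | ⟨rfl, rfl⟩
    · refine absurd ?_ hut
      rw [hf _ _ huv hu hv, htrue _ (by simp [h'.1, h]) hv]
    · rw [h, sgn, add_neg_cancel_right]
  have hno : ∀ u : TwinClass m, u.1 = true → layer k u ∉ D → layer (k + 1) u.flip ∉ D →
      f (layer k u) = t := by
    intro u h hu hv
    by_contra hut
    have huv : Adj (layer k u) (layer (k + 1) u.flip) := by
      have := layer_adj_flip k u
      rwa [h] at this
    have hvt : f (layer (k + 1) u.flip) ≠ t := by rwa [← hf _ _ huv hu hv]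
    obtain ⟨w, hw, ⟨h', hwne⟩ | ⟨h', hwne⟩⟩ := hedge _ hu _ hv huv
    · exact hwne (hk u h hu hut w hw h')
    · have := hk1 u.flip (by simp [flip, h]) hv hvt w hw h'
      rw [flip_flip] at this
      exact hwne this
  obtain ⟨j, u, rfl⟩ := layer_surjective w
  by_contra hne
  by_cases hj : j = k
  · subst hj
    cases h : u.1
    · exact hne (hfalse u h hw)
    · obtain ⟨v, hv, huv⟩ := hiso _ hw
      obtain rfl := hk u h hw hne v hv huv
      exact hne (hno u h hw hv)
  · by_cases hj1 : j = k + 1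
    · subst hj1
      cases h : u.1
      · obtain ⟨v, hv, huv⟩ := hiso _ hw
        obtain rfl := hk1 u h hw hne v hv huv
        rw [hf _ _ huv hw hv] at hne
        exact hne (hno u.flip (by simp [flip, h]) hv (by rwa [flip_flip]))
      · exact hne (htrue u h hw)
    · exact hne (ht j hj hj1 u)

/-- Deleting at most `2 (m + 1)` classes leaves the `(m + 2)`-regular graph of classes connected
if no component has at most two classes. -/
theorem exists_forall_eq_of_card_le_two_mul {m : ℕ} {β : Type*} (hm : 1 ≤ m)
    (D : Finset (TwinClass (m + 1))) (f : TwinClass (m + 1) → β) (hD : D.card ≤ 2 * (m + 1))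
    (hf : Compatible D f) (hiso : ∀ u ∉ D, ∃ v ∉ D, Adj u v)
    (hedge : ∀ u ∉ D, ∀ v ∉ D, Adj u v → ∃ w ∉ D, Adj u w ∧ w ≠ v ∨ Adj v w ∧ w ≠ u) :
    ∃ t, ∀ u ∉ D, f u = t := by
  obtain ⟨t, ht, hlink⟩ := exists_layer_values hf exists_forall_eq_of_card_le
  by_cases h1 : ∃ k, ∀ j, j ≠ k → (slice D j).card ≤ m
  · obtain ⟨k, hk⟩ := h1
    have hv := values_eq hlink (k := k) hk
    have ht' : ∀ j ≠ k, ∀ u, layer j u ∉ D → f (layer j u) = t (k + 1) := fun j hj u hu => by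
      rw [ht j (hk j hj) u hu, hv j hj]
    refine ⟨t (k + 1), fun w hw => ?_⟩
    obtain ⟨j, u, rfl⟩ := layer_surjective w
    by_cases hj : j = k
    · subst hj
      exact eq_of_forall_layer_ne hm hD hf hiso hedge ht' u hw
    · exact ht' j hj u hw
  push Not at h1
  -- The argument `0` is arbitrary: it yields one heavy layer `k`, and applying `h1` to `k` yields
  -- another.
  obtain ⟨k, -, hk⟩ := h1 0
  obtain ⟨j, hjk, hj⟩ := h1 k
  -- Two heavy layers take at least `m + 1` deletions each, which exhausts the budget and leaves the
  -- other two layers undamaged.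
  have consec : ∀ k, m < (slice D k).card → m < (slice D (k + 1)).card →
      ∃ t, ∀ u ∉ D, f u = t := by
    intro k hk hk1
    have hc := card_eq_slices D k
    have hz : ∀ j, j ≠ k → j ≠ k + 1 → (slice D j).card = 0 := by
      intro j hj hj1
      rcases eq_add_of_ne hj with rfl | rfl | rfl
      · exact absurd rfl hj1
      · omega
      · omega
    have e : k + 2 + 1 = k + 3 := by ring
    have hl := hlink (k + 2) (by omega) (by rw [e]; omega)
    rw [e] at hl
    have hD' : ∀ j, j ≠ k → j ≠ k + 1 → ∀ u, layer j u ∉ D := fun j hj hj1 u =>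
      notMem_of_slice_card_eq_zero (hz j hj hj1) u
    refine ⟨t (k + 2), eq_of_forall_layer_ne_ne hf hiso hedge hD' fun j hj hj1 u => ?_⟩
    rw [ht j (by rw [hz j hj hj1]; omega) u (hD' j hj hj1 u)]
    rcases eq_add_of_ne hj with rfl | rfl | rfl
    · exact absurd rfl hj1
    · rfl
    · exact hl.symm
  rcases eq_add_of_ne hjk with rfl | rfl | rfl
  · exact consec k hk hj
  · have hc := card_eq_slices D k
    have hz1 : (slice D (k + 1)).card = 0 := by omega
    have hz3 : (slice D (k + 3)).card = 0 := by omega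
    have e3 : k - 1 = k + 3 := by clear * - k; decide +revert
    have e4 : k + 2 + 1 = k + 3 := by ring
    have e5 : k + 2 - 1 = k + 1 := by ring
    have l1 : ∀ u, f (layer (k + 1) u) = t (k + 1) := fun u =>
      ht _ (by omega) u (notMem_of_slice_card_eq_zero hz1 u)
    have l3 : ∀ u, f (layer (k + 3) u) = t (k + 3) := fun u =>
      ht _ (by omega) u (notMem_of_slice_card_eq_zero hz3 u)
    have up : ∀ u : TwinClass m, u.1 = true → layer k u ∉ D → f (layer k u) = t (k + 1) := by
      intro u h hu
      have := layer_adj_flip k u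
      rw [h, sgn] at this
      rw [hf _ _ this hu (notMem_of_slice_card_eq_zero hz1 _), l1]
    have down : ∀ u : TwinClass m, u.1 = false → layer k u ∉ D → f (layer k u) = t (k + 3) := by
      intro u h hu
      have := layer_adj_flip k u
      rw [h, sgn, ← sub_eq_add_neg, e3] at this
      rw [hf _ _ this hu (notMem_of_slice_card_eq_zero hz3 _), l3]
    -- With opposite heavy layers, every class of a heavy layer points to an undamaged one. The two
    -- undamaged layers are linked by a surviving edge inside layer `k`, whose ends point to
    -- different sides.
    have h13 : t (k + 1) = t (k + 3) := by
      obtain ⟨x, hx⟩ := exists_forall_notMem (D := slice D k) (E := ∅) (by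
        have : m + 1 < 4 ^ m := lt_of_le_of_lt (by omega) (two_mul_lt_four_pow m)
        rw [Finset.card_empty]
        omega)
      have hx1 := (hx true).1
      have hx2 := (hx false).1
      rw [mem_slice] at hx1 hx2
      rw [← up _ rfl hx1, ← down _ rfl hx2]
      exact hf _ _ (layer_adj_layer (adj_flip (true, x))) hx1 hx2
    refine ⟨t (k + 1), fun w hw => ?_⟩
    obtain ⟨i, u, rfl⟩ := layer_surjective w
    by_cases hi : i = k
    · subst hi
      cases h : u.1
      · rw [down u h hw, h13]
      · exact up u h hw
    · rcases eq_add_of_ne hi with rfl | rfl | rfl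
      · exact l1 u
      · have := layer_adj_flip (k + 2) u
        cases h : u.1
        · rw [h, sgn, ← sub_eq_add_neg, e5] at this
          rw [hf _ _ this hw (notMem_of_slice_card_eq_zero hz1 _), l1]
        · rw [h, sgn, e4] at this
          rw [hf _ _ this hw (notMem_of_slice_card_eq_zero hz3 _), l3, h13]
      · rw [l3, h13]
  · refine consec (k + 3) hj ?_
    have e : k + 3 + 1 = k := by clear * - k; decide +revert
    rwa [e]

end TwinClass

/-! ### Stars as subgraphs -/

section Star

open SimpleGraph

lemma exists_star_of_iso {V : Type*} {G : SimpleGraph V} {S : G.Subgraph}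
    (h : Nonempty (S.coe ≃g completeBipartiteGraph (Fin 1) (Fin 3))) :
    ∃ (c : V) (L : Finset V), L.card = 3 ∧ (∀ l ∈ L, G.Adj c l) ∧ S.verts = insert c ↑L := by
  classical
  obtain ⟨e⟩ := h
  have hinj : Function.Injective fun i : Fin 3 => (e.symm (Sum.inr i) : V) :=
    Subtype.val_injective.comp (e.symm.injective.comp Sum.inr_injective)
  refine ⟨e.symm (Sum.inl 0), Finset.univ.image fun i => (e.symm (Sum.inr i) : V), ?_, ?_, ?_⟩
  · rw [Finset.card_image_of_injective _ hinj, Finset.card_univ, Fintype.card_fin]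
  · intro l hl
    obtain ⟨i, -, rfl⟩ := Finset.mem_image.1 hl
    refine S.adj_sub ?_
    rw [← Subgraph.coe_adj, e.symm.map_adj_iff]
    simp
  · ext a
    simp only [Finset.coe_image, Finset.coe_univ, Set.image_univ, Set.mem_insert_iff,
      Set.mem_range]
    constructor
    · intro ha
      rcases h : e ⟨a, ha⟩ with i | i
      · left
        rw [← Subsingleton.elim i 0, ← h]
        simp
      · right
        refine ⟨i, ?_⟩
        rw [← h]
        simp
    · rintro (rfl | ⟨i, rfl⟩) <;> exact Subtype.property _

lemma completeBipartiteGraph_one_connected :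
    (completeBipartiteGraph (Fin 1) (Fin 3)).Connected := by
  have h : ∀ v, (completeBipartiteGraph (Fin 1) (Fin 3)).Reachable (Sum.inl 0) v := by
    rintro (i | i)
    · rw [Subsingleton.elim i 0]
    · exact Adj.reachable (by simp)
  exact { preconnected := fun u v => (h u).symm.trans (h v), nonempty := ⟨Sum.inl 0⟩ }

lemma exists_star_subgraph {V : Type*} {G : SimpleGraph V} {c : V} {ℓ : Fin 3 → V}
    (hℓ : Function.Injective ℓ) (hadj : ∀ i, G.Adj c (ℓ i)) :
    ∃ S : G.Subgraph, S.verts = insert c (Set.range ℓ) ∧ S.Connected ∧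
      Nonempty (S.coe ≃g completeBipartiteGraph (Fin 1) (Fin 3)) := by
  let f : completeBipartiteGraph (Fin 1) (Fin 3) →g G :=
    { toFun := Sum.elim (fun _ => c) ℓ
      map_rel' := by
        rintro (a | a) (b | b) h
        · simp at h
        · exact hadj b
        · exact (hadj a).symm
        · simp at h }
  have hf : Function.Injective f :=
    Function.Injective.sumElim (Function.injective_of_subsingleton _) hℓ fun _ i => (hadj i).ne
  let C : Copy (completeBipartiteGraph (Fin 1) (Fin 3)) G := ⟨f, hf⟩
  refine ⟨C.toSubgraph, ?_, ⟨C.isoToSubgraph.connected_iff.1 completeBipartiteGraph_one_connected⟩,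
    ⟨C.isoToSubgraph.symm⟩⟩
  ext a
  simp [C, f, eq_comm]

end Star

/-! ### Upper bound: isolating a vertex -/

section Upper

variable {n : ℕ} [NeZero n]

lemma balancedHypercube_adj_of_zero {c b : Fin n → ZMod 4} (hc : c 0 = 0)
    (hb : b 0 = 1 ∨ b 0 = 3) (h : (∀ j, j ≠ 0 → b j = c j) ∨
      ∃ i, i ≠ 0 ∧ b i = c i + 1 ∧ ∀ j, j ≠ 0 → j ≠ i → b j = c j) :
    (balancedHypercube n).Adj c b := by
  refine ⟨?_, ?_⟩
  · rw [hc, zero_add, zero_sub]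
    exact hb
  · rw [hc]
    simpa using h

/-- The centres of the stars isolating `0`. -/
def starCenter (o j : Fin n) : Fin n → ZMod 4 := if j = 0 then Pi.single o 3 else Pi.single j 1

/-- The leaves of the stars isolating `0`. -/
def starLeaf (o j : Fin n) : Fin 3 → Fin n → ZMod 4 :=
  ![Function.update (if j = 0 then 0 else Pi.single j 1) 0 1,
    Function.update (if j = 0 then 0 else Pi.single j 1) 0 3,
    Function.update (if j = 0 then Pi.single o 3 else Pi.single j 2) 0 1]

lemma starLeaf_injective {o : Fin n} (ho : o ≠ 0) (j : Fin n) :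
    Function.Injective (starLeaf o j) := by
  have h13 : (1 : ZMod 4) ≠ 3 := by decide
  have h12 : (1 : ZMod 4) ≠ 2 := by decide
  have h03 : (0 : ZMod 4) ≠ 3 := by decide
  have key : ∀ a b : Fin n → ZMod 4, (∃ i, a i ≠ b i) → a ≠ b := by
    rintro a b ⟨i, h⟩ rfl; exact h rfl
  have h1 : starLeaf o j 0 ≠ starLeaf o j 1 := key _ _ ⟨0, by simp [starLeaf, h13]⟩
  have h2 : starLeaf o j 1 ≠ starLeaf o j 2 := key _ _ ⟨0, by simp [starLeaf, h13.symm]⟩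
  have h3 : starLeaf o j 0 ≠ starLeaf o j 2 := by
    by_cases hj : j = 0
    · exact key _ _ ⟨o, by simp [starLeaf, hj, ho, h03]⟩
    · exact key _ _ ⟨j, by simp [starLeaf, hj, h12]⟩
  intro a b h
  fin_cases a <;> fin_cases b <;> simp_all

lemma starCenter_adj_starLeaf {o : Fin n} (ho : o ≠ 0) (j : Fin n) (i : Fin 3) :
    (balancedHypercube n).Adj (starCenter o j) (starLeaf o j i) := by
  have h31 : (0 : ZMod 4) = 3 + 1 := by decide
  have h2 : (2 : ZMod 4) = 1 + 1 := by decide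
  refine balancedHypercube_adj_of_zero ?_ ?_ ?_
  · by_cases hj : j = 0
    · simp [starCenter, hj, ho.symm]
    · simp [starCenter, hj, Ne.symm hj]
  · fin_cases i <;> simp [starLeaf]
  · by_cases hj : j = 0
    · fin_cases i
      · exact Or.inr ⟨o, ho, by simp [starLeaf, starCenter, hj, ho, h31],
          fun k hk hko => by simp [starLeaf, starCenter, hj, hk, hko]⟩
      · exact Or.inr ⟨o, ho, by simp [starLeaf, starCenter, hj, ho, h31],
          fun k hk hko => by simp [starLeaf, starCenter, hj, hk, hko]⟩
      · exact Or.inl fun k hk => by simp [starLeaf, starCenter, hj, hk]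
    · fin_cases i
      · exact Or.inl fun k hk => by simp [starLeaf, starCenter, hj, hk]
      · exact Or.inl fun k hk => by simp [starLeaf, starCenter, hj, hk]
      · exact Or.inr ⟨j, hj, by simp [starLeaf, starCenter, hj, h2],
          fun k hk hkj => by simp [starLeaf, starCenter, hj, hk, hkj]⟩

/-- An outer coordinate equal to `1` or `2` identifies the star: star `j ≠ 0` has one exactly at
`j`, while star `0` uses only the outer values `0` and `3`. This gives disjointness; the second part
keeps `0` and its twin outside all stars. -/
lemma star_coord {o : Fin n} (ho : o ≠ 0) {j : Fin n} {a : Fin n → ZMod 4}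
    (ha : a ∈ insert (starCenter o j) (Set.range (starLeaf o j))) :
    (∀ i, i ≠ 0 → ((a i = 1 ∨ a i = 2) ↔ i = j)) ∧
      ¬ ((a 0 = 0 ∨ a 0 = 2) ∧ ∀ i, i ≠ 0 → a i = 0) := by
  have e : ¬ (3 : ZMod 4) = 1 ∧ ¬ (3 : ZMod 4) = 2 ∧ ¬ (3 : ZMod 4) = 0 ∧ ¬ (0 : ZMod 4) = 1 ∧
    ¬ (0 : ZMod 4) = 2 ∧ ¬ (1 : ZMod 4) = 2 ∧ ¬ (1 : ZMod 4) = 0 ∧ ¬ (2 : ZMod 4) = 0 := by decide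
  obtain ⟨e1, e2, e3, e4, e5, e6, e7, e8⟩ := e
  have key : ∀ i, i ≠ 0 → ((a i = 1 ∨ a i = 2) ↔ i = j) := by
    intro i hi
    by_cases hj : j = 0
    · rcases ha with rfl | ⟨l, rfl⟩
      · by_cases hio : i = o <;> simp [starCenter, hj, hi, hio, ho, e1, e2, e4, e5]
      · by_cases hio : i = o <;> fin_cases l <;>
          simp [starLeaf, hj, hi, hio, ho, e1, e2, e4, e5]
    · rcases ha with rfl | ⟨l, rfl⟩
      · by_cases hij : i = j <;> simp [starCenter, hj, hij, e4, e5]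
      · by_cases hij : i = j <;> fin_cases l <;>
          simp [starLeaf, hj, hi, hij, e4, e5]
  refine ⟨key, fun ⟨h0, h⟩ => ?_⟩
  by_cases hj : j = 0
  · rcases ha with rfl | ⟨l, rfl⟩
    · have := h o ho
      simp [starCenter, hj, e3] at this
    · fin_cases l <;> simp [starLeaf, e2, e3, e6, e7] at h0
  · have := (key j hj).2 rfl
    rw [h j hj] at this
    exact this.elim e4 e5

/-- A neighbour of `0` is determined by the outer index it changes (`j = 0` meaning none) and by its
inner index `1` or `3`; these are the first two leaves of star `j`. -/
lemma exists_mem_star_of_adj_zero (o : Fin n) {b : Fin n → ZMod 4}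
    (h : (balancedHypercube n).Adj 0 b) : ∃ j, b ∈ Set.range (starLeaf o j) := by
  obtain ⟨h0, h⟩ := h
  have hb : b 0 = 1 ∨ b 0 = 3 := by
    rw [Pi.zero_apply, zero_add, zero_sub] at h0
    exact h0
  obtain ⟨j, hj⟩ : ∃ j : Fin n,
      ∀ i, i ≠ 0 → b i = (if j = 0 then 0 else Pi.single j 1 : Fin n → ZMod 4) i := by
    rcases h with h | ⟨i, hi, hbi, h⟩
    · exact ⟨0, fun i hi => by simp [h i hi]⟩
    · refine ⟨i, fun k hk => ?_⟩
      by_cases hki : k = i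
      · subst hki
        simpa [hi] using hbi
      · simp [h k hk hki, hi, hki]
  have hup : ∀ s, b 0 = s →
      b = Function.update (if j = 0 then 0 else Pi.single j 1 : Fin n → ZMod 4) 0 s := by
    intro s hs
    ext i
    by_cases hi : i = 0
    · subst hi; simp [hs]
    · rw [hj i hi, Function.update_of_ne hi]
  rcases hb with hb | hb
  · exact ⟨j, 0, (hup 1 hb).symm⟩
  · exact ⟨j, 1, (hup 3 hb).symm⟩

/-- `n` stars isolate a vertex of `BH_n`. -/
theorem exists_isStructureCut (hn : 2 ≤ n) : ∃ F : Set (balancedHypercube n).Subgraph,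
    IsStructureCut (balancedHypercube n) (completeBipartiteGraph (Fin 1) (Fin 3)) F ∧
      F.encard = n := by
  obtain ⟨o, ho⟩ : ∃ o : Fin n, o ≠ 0 := ⟨⟨1, hn⟩, by simp [Fin.ext_iff]⟩
  choose S hverts hconn hiso using fun j : Fin n =>
    exists_star_subgraph (starLeaf_injective ho j) (starCenter_adj_starLeaf ho j)
  have hdisj : ∀ i j, i ≠ j → Disjoint (S i).verts (S j).verts := by
    intro i j hij
    refine Set.disjoint_left.2 fun a hi hj => ?_
    rw [hverts] at hi hj
    have hi' := (star_coord ho hi).1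
    have hj' := (star_coord ho hj).1
    by_cases h : i = 0
    · have hj0 : j ≠ 0 := fun e => hij (h.trans e.symm)
      exact hij ((hi' j hj0).1 ((hj' j hj0).2 rfl)).symm
    · exact hij ((hj' i h).1 ((hi' i h).2 rfl))
  have hinj : Function.Injective S := by
    intro i j h
    by_contra hij
    have := hdisj i j hij
    rw [h, disjoint_self] at this
    exact (hconn j).nonempty.ne_empty this
  have hmem : ∀ a, a ∈ subgraphVerts (Set.range S) ↔ ∃ j, a ∈ (S j).verts := by
    simp [subgraphVerts]
  have hout : ∀ a : Fin n → ZMod 4, (a 0 = 0 ∨ a 0 = 2) → (∀ i, i ≠ 0 → a i = 0) →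
      a ∈ (subgraphVerts (Set.range S))ᶜ := by
    intro a h0 h ha
    obtain ⟨j, hj⟩ := (hmem a).1 ha
    rw [hverts] at hj
    exact (star_coord ho hj).2 ⟨h0, h⟩
  refine ⟨Set.range S, ⟨⟨?_, ?_, Or.inl fun hpre => ?_⟩, ?_⟩, ?_⟩
  · rintro _ ⟨j, rfl⟩
    exact hconn j
  · rintro _ ⟨i, rfl⟩ _ ⟨j, rfl⟩ hij
    exact hdisj i j fun e => hij (by rw [e])
  · have hnone : ∀ v, ¬ ((balancedHypercube n).induce (subgraphVerts (Set.range S))ᶜ).Adj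
        ⟨0, hout 0 (by simp) (by simp)⟩ v := by
      intro v h
      obtain ⟨j, hj⟩ := exists_mem_star_of_adj_zero o (SimpleGraph.induce_adj.1 h)
      refine v.2 ((hmem _).2 ⟨j, ?_⟩)
      rw [hverts]
      exact Or.inr hj
    have hzero : ∀ v : ((subgraphVerts (Set.range S))ᶜ : Set (Fin n → ZMod 4)),
        v = ⟨0, hout 0 (by simp) (by simp)⟩ := by
      intro v
      obtain ⟨p⟩ := hpre ⟨0, hout 0 (by simp) (by simp)⟩ v
      cases p with
      | nil => rfl
      | cons h p => exact absurd h (hnone _)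
    -- The twin of `0` also survives, so isolating `0` does disconnect.
    have h2 : (Pi.single 0 2 : Fin n → ZMod 4) 0 = (0 : Fin n → ZMod 4) 0 := congrFun
      (Subtype.ext_iff.1 (hzero ⟨_, hout (Pi.single 0 2) (by simp) fun i hi => by simp [hi]⟩)) 0
    have : (2 : ZMod 4) ≠ 0 := by decide
    simp [this] at h2
  · rintro _ ⟨j, rfl⟩
    exact hiso j
  · rw [← Set.image_univ, hinj.encard_image]
    simp

end Upper

/-! ### Lower bound: few stars do not disconnect -/

section Lower

open TwinClass

variable {m : ℕ}

/-- The twin class of a vertex of `BH_{m+1}`. -/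
def toTwinClass (a : Fin (m + 1) → ZMod 4) : TwinClass m := (decide ((a 0).val % 2 = 0), Fin.tail a)

/-- The other vertex with the same neighbourhood. -/
def twin (a : Fin (m + 1) → ZMod 4) : Fin (m + 1) → ZMod 4 := Fin.cons (a 0 + 2) (Fin.tail a)

lemma twin_ne (a : Fin (m + 1) → ZMod 4) : twin a ≠ a := by
  intro h
  have h0 : a 0 + 2 = a 0 := by simpa [twin] using congrFun h 0
  have : ∀ x : ZMod 4, x + 2 ≠ x := by decide
  exact this _ h0

lemma toTwinClass_eq_iff {a b : Fin (m + 1) → ZMod 4} :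
    toTwinClass b = toTwinClass a ↔ b = a ∨ b = twin a := by
  have key : ∀ x y : ZMod 4, (decide (y.val % 2 = 0) = decide (x.val % 2 = 0)) ↔
      y = x ∨ y = x + 2 := by decide
  obtain ⟨x, a, rfl⟩ : ∃ x a', a = Fin.cons x a' := ⟨a 0, Fin.tail a, by simp⟩
  obtain ⟨y, b, rfl⟩ : ∃ x a', b = Fin.cons x a' := ⟨b 0, Fin.tail b, by simp⟩
  simp only [toTwinClass, twin, Prod.ext_iff, Fin.cons_zero, Fin.tail_cons, key, Fin.cons_inj]
  tauto

lemma toTwinClass_surjective : Function.Surjective (toTwinClass (m := m)) := by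
  rintro ⟨_ | _, x⟩
  · exact ⟨Fin.cons 1 x, by simp [toTwinClass]; decide⟩
  · exact ⟨Fin.cons 0 x, by simp [toTwinClass]⟩

/-- Both the change of inner index and the sign `(-1) ^ a_0` depend only on parities. -/
lemma balancedHypercube_adj_iff {a b : Fin (m + 1) → ZMod 4} :
    (balancedHypercube (m + 1)).Adj a b ↔ Adj (toTwinClass a) (toTwinClass b) := by
  have key : ∀ x y : ZMod 4, (y = x + 1 ∨ y = x - 1) ↔
      decide (y.val % 2 = 0) = !decide (x.val % 2 = 0) := by decide
  have key' : ∀ x : ZMod 4, (-1 : ZMod 4) ^ x.val = sgn (decide (x.val % 2 = 0)) := by decide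
  change (_ ∧ _) ↔ (_ ∧ _)
  refine and_congr (key _ _) (or_congr ?_ ?_)
  · simp only [toTwinClass, Fin.forall_fin_succ, funext_iff, Fin.tail]
    simp
  · rw [key']
    simp only [toTwinClass, Fin.exists_fin_succ, funext_iff]
    simp only [ne_eq, not_true_eq_false, false_and, Fin.succ_ne_zero, not_false_eq_true, true_and,
      false_or]
    refine exists_congr fun i => ?_
    constructor
    · rintro ⟨h1, h2⟩ j
      by_cases hj : j = i
      · subst hj; simpa [Fin.tail] using h1
      · simpa [Fin.tail, hj] using h2 j.succ (by simp) (by simpa using hj)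
    · intro h
      refine ⟨by simpa [Fin.tail] using h i, fun j => ?_⟩
      refine Fin.cases (by simp) (fun j _ hj => ?_) j
      have hj : j ≠ i := by simpa using hj
      simpa [Fin.tail, hj] using h j

open Classical in
/-- The vertices whose classes belong to `T`. -/
noncomputable def classVerts (T : Finset (TwinClass m)) : Finset (Fin (m + 1) → ZMod 4) :=
  Finset.univ.filter fun a => toTwinClass a ∈ T

lemma mem_classVerts {T : Finset (TwinClass m)} {a : Fin (m + 1) → ZMod 4} :
    a ∈ classVerts T ↔ toTwinClass a ∈ T := by simp [classVerts]

lemma card_classVerts (T : Finset (TwinClass m)) : (classVerts T).card = 2 * T.card := by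
  classical
  rw [Finset.card_eq_sum_card_fiberwise (f := toTwinClass) (t := T)
    (fun a ha => mem_classVerts.1 ha), mul_comm, ← smul_eq_mul, ← Finset.sum_const]
  refine Finset.sum_congr rfl fun w hw => ?_
  obtain ⟨a, rfl⟩ := toTwinClass_surjective w
  rw [← Finset.card_pair (twin_ne a).symm]
  congr 1
  ext b
  simp only [Finset.mem_filter, mem_classVerts, Finset.mem_insert, Finset.mem_singleton,
    ← toTwinClass_eq_iff]
  constructor
  · exact fun h => h.2
  · exact fun h => ⟨by rwa [h], h⟩

/-- A family of stars in `BH_{m+1}` with distinct centres, given by their centres and leaves. -/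
structure IsStarFamily {ι : Type*} (I : Finset ι) (c : ι → Fin (m + 1) → ZMod 4)
    (L : ι → Finset (Fin (m + 1) → ZMod 4)) : Prop where
  card_leaves : ∀ s ∈ I, (L s).card = 3
  adj : ∀ s ∈ I, ∀ l ∈ L s, Adj (toTwinClass (c s)) (toTwinClass l)
  injOn : ∀ s ∈ I, ∀ t ∈ I, c s = c t → s = t

open Classical in
/-- The vertices of a family of stars. -/
noncomputable def starVerts {ι : Type*} (I : Finset ι) (c : ι → Fin (m + 1) → ZMod 4)
    (L : ι → Finset (Fin (m + 1) → ZMod 4)) : Finset (Fin (m + 1) → ZMod 4) :=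
  I.biUnion fun s => insert (c s) (L s)

open Classical in
/-- The classes contained in a set of vertices. -/
noncomputable def fullClasses (R : Finset (Fin (m + 1) → ZMod 4)) : Finset (TwinClass m) :=
  Finset.univ.filter fun w => ∀ a, toTwinClass a = w → a ∈ R

lemma notMem_fullClasses {R : Finset (Fin (m + 1) → ZMod 4)} {w : TwinClass m} :
    w ∉ fullClasses R ↔ ∃ a ∉ R, toTwinClass a = w := by
  simp only [fullClasses, Finset.mem_filter, Finset.mem_univ, true_and]
  push Not
  exact exists_congr fun a => and_comm

lemma classVerts_fullClasses_subset (R : Finset (Fin (m + 1) → ZMod 4)) :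
    classVerts (fullClasses R) ⊆ R := by
  intro a ha
  rw [mem_classVerts] at ha
  by_contra h
  exact notMem_fullClasses.2 ⟨a, h, rfl⟩ ha

namespace IsStarFamily

variable {ι : Type*} {I : Finset ι} {c : ι → Fin (m + 1) → ZMod 4}
  {L : ι → Finset (Fin (m + 1) → ZMod 4)}

lemma center_mem {s : ι} (hs : s ∈ I) : c s ∈ starVerts I c L :=
  Finset.mem_biUnion.2 ⟨s, hs, Finset.mem_insert_self _ _⟩

lemma leaf_mem {s : ι} (hs : s ∈ I) {l : Fin (m + 1) → ZMod 4} (hl : l ∈ L s) :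
    l ∈ starVerts I c L :=
  Finset.mem_biUnion.2 ⟨s, hs, Finset.mem_insert_of_mem hl⟩

lemma card_starVerts_le (h : IsStarFamily I c L) : (starVerts I c L).card ≤ I.card * 4 := by
  classical
  exact Finset.card_biUnion_le_card_mul _ _ _ fun s hs =>
    (Finset.card_insert_le _ _).trans (by rw [h.card_leaves s hs])

/-- At most four vertices per star, and two vertices per full class. -/
lemma card_fullClasses_le (h : IsStarFamily I c L) :
    (fullClasses (starVerts I c L)).card ≤ 2 * I.card := by
  have h1 := Finset.card_le_card (classVerts_fullClasses_subset (starVerts I c L))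
  rw [card_classVerts] at h1
  have := h.card_starVerts_le
  omega

/-- At most `m` stars do not contain all neighbours of a vertex outside them. -/
lemma exists_adj_notMem (h : IsStarFamily I c L) (hI : I.card ≤ m) {v : Fin (m + 1) → ZMod 4}
    (hv : v ∉ starVerts I c L) :
    ∃ b ∉ starVerts I c L, Adj (toTwinClass v) (toTwinClass b) := by
  classical
  by_contra! hno
  set N := classVerts (nbrs (toTwinClass v)) with hN
  have memN : ∀ b, b ∈ N ↔ Adj (toTwinClass v) (toTwinClass b) := fun b => by
    rw [hN, mem_classVerts, mem_nbrs]
  have hsub : N ⊆ I.biUnion fun s => insert (c s) (L s) ∩ N := by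
    intro b hb
    have hbR : b ∈ starVerts I c L := by
      by_contra hbR
      exact hno b hbR ((memN b).1 hb)
    obtain ⟨s, hs, hbs⟩ := Finset.mem_biUnion.1 hbR
    exact Finset.mem_biUnion.2 ⟨s, hs, Finset.mem_inter.2 ⟨hbs, hb⟩⟩
  -- A centre in `N` excludes its leaves by parity. Otherwise only leaves count, and they lie in at
  -- most one common class, unless the centre is the twin of `v`, when all three may count. Centres
  -- being distinct, this happens once, so at most `2m + 1` of the `2m + 2` neighbours are covered.
  have hone : ∀ s ∈ I, (insert (c s) (L s) ∩ N).card ≤ 2 + if c s = twin v then 1 else 0 := by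
    intro s hs
    by_cases hc : c s ∈ N
    · have : insert (c s) (L s) ∩ N ⊆ {c s} := by
        intro b hb
        rw [Finset.mem_inter, Finset.mem_insert] at hb
        obtain ⟨rfl | hb, hbN⟩ := hb
        · simp
        · have h1 := (h.adj s hs b hb).1
          have h2 := ((memN _).1 hc).1
          have h3 := ((memN _).1 hbN).1
          rw [h3, h2] at h1
          simp at h1
      have := Finset.card_le_card this
      rw [Finset.card_singleton] at this
      omega
    · have hL : insert (c s) (L s) ∩ N ⊆ L s ∩ N := by
        intro b hb
        rw [Finset.mem_inter, Finset.mem_insert] at hb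
        obtain ⟨rfl | hb, hbN⟩ := hb
        · exact absurd hbN hc
        · exact Finset.mem_inter.2 ⟨hb, hbN⟩
      have h3 := Finset.card_le_card hL
      by_cases ht : c s = twin v
      · rw [if_pos ht]
        have := Finset.card_le_card (Finset.inter_subset_left (s₁ := L s) (s₂ := N))
        rw [h.card_leaves s hs] at this
        omega
      · have hne : toTwinClass (c s) ≠ toTwinClass v := by
          intro he
          rcases toTwinClass_eq_iff.1 he with he | he
          · exact hv (he ▸ center_mem hs)
          · exact ht he
        have : L s ∩ N ⊆ classVerts (nbrs (toTwinClass (c s)) ∩ nbrs (toTwinClass v)) := by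
          intro b hb
          rw [Finset.mem_inter] at hb
          rw [mem_classVerts, Finset.mem_inter, mem_nbrs, mem_nbrs]
          exact ⟨h.adj s hs b hb.1, (memN b).1 hb.2⟩
        have := Finset.card_le_card this
        rw [card_classVerts] at this
        have := card_inter_nbrs_le hne
        omega
  have hcard : N.card = 2 * (m + 1) := by rw [hN, card_classVerts, card_nbrs]
  have h1 := (Finset.card_le_card hsub).trans
    (Finset.card_biUnion_le.trans (Finset.sum_le_sum hone))
  rw [Finset.sum_add_distrib, Finset.sum_const, smul_eq_mul, ← Finset.card_filter] at h1
  have h2 : (I.filter fun s => c s = twin v).card ≤ 1 := by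
    refine Finset.card_le_one.2 fun s hs t ht => ?_
    rw [Finset.mem_filter] at hs ht
    exact h.injOn s hs.1 t ht.1 (hs.2.trans ht.2.symm)
  omega

/-- At most `m` stars do not contain all classes adjacent to an edge. -/
lemma exists_adj_notMem_fullClasses (h : IsStarFamily I c L) (hI : I.card ≤ m) (hm : 1 ≤ m)
    {x y : TwinClass m} (hxy : Adj x y) :
    ∃ w ∉ fullClasses (starVerts I c L), Adj x w ∧ w ≠ y ∨ Adj y w ∧ w ≠ x := by
  classical
  by_contra! hno
  set D := fullClasses (starVerts I c L) with hDdef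
  set T := (nbrs x).erase y ∪ (nbrs y).erase x with hT
  have hTD : T ⊆ D := by
    intro w hw
    by_contra hwD
    rw [hT, Finset.mem_union, Finset.mem_erase, Finset.mem_erase, mem_nbrs, mem_nbrs] at hw
    rcases hw with hw | hw
    · exact hw.1 ((hno w hwD).1 hw.2)
    · exact hw.1 ((hno w hwD).2 hw.2)
  have hTcard : T.card = 2 * m := by
    rw [hT, Finset.card_union_of_disjoint, Finset.card_erase_of_mem (mem_nbrs.2 hxy),
      Finset.card_erase_of_mem (mem_nbrs.2 hxy.symm), card_nbrs, card_nbrs]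
    · omega
    · refine Finset.disjoint_left.2 fun w hw hw' => ?_
      have h1 := (mem_nbrs.1 (Finset.mem_of_mem_erase hw)).1
      have h2 := (mem_nbrs.1 (Finset.mem_of_mem_erase hw')).1
      rw [h1, hxy.1] at h2
      simp at h2
  have hDcard : D.card ≤ 2 * I.card := h.card_fullClasses_le
  -- The bound `2m` is tight, so the stars consist exactly of the vertices whose classes lie in `T`.
  have hDT : T = D := Finset.eq_of_subset_of_card_le hTD (by omega)
  have hR : classVerts D = starVerts I c L := by
    refine Finset.eq_of_subset_of_card_le (classVerts_fullClasses_subset _) ?_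
    rw [card_classVerts, ← hDT, hTcard]
    have := h.card_starVerts_le
    omega
  have hI0 : I.Nonempty := by
    have := Finset.card_le_card hTD
    exact Finset.card_pos.1 (by omega)
  obtain ⟨s, hs⟩ := hI0
  obtain ⟨l, hl⟩ : (L s).Nonempty := Finset.card_pos.1 (by rw [h.card_leaves s hs]; simp)
  have hmem : ∀ a ∈ starVerts I c L, (Adj x (toTwinClass a) ∧ toTwinClass a ≠ y) ∨
      (Adj y (toTwinClass a) ∧ toTwinClass a ≠ x) := by
    intro a ha
    rw [← hR, mem_classVerts, ← hDT, hT, Finset.mem_union, Finset.mem_erase, Finset.mem_erase,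
      mem_nbrs, mem_nbrs] at ha
    tauto
  have hadj := h.adj s hs l hl
  -- A centre and a leaf give an edge inside `T`: on one side of `xy` parity forbids it, and across
  -- the sides it would close a 4-cycle with `xy`.
  rcases hmem _ (center_mem hs) with ⟨h1, h1'⟩ | ⟨h1, h1'⟩ <;>
    rcases hmem _ (leaf_mem hs hl) with ⟨h2, h2'⟩ | ⟨h2, h2'⟩
  · have := hadj.1
    rw [h1.1, h2.1] at this
    simp at this
  · rcases eq_or_eq_of_adj h1 hxy hadj.symm h2.symm with h | h
    · exact h2' h.symm
    · exact h1' h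
  · rcases eq_or_eq_of_adj h1 hxy.symm hadj.symm h2.symm with h | h
    · exact h2' h.symm
    · exact h1' h
  · have := hadj.1
    rw [h1.1, h2.1] at this
    simp at this

/-- A function on the classes that is compatible off at most `m` stars is constant there. -/
lemma exists_forall_eq (h : IsStarFamily I c L) (hI : I.card ≤ m) (hm : 1 ≤ m) {β : Type*}
    {f : TwinClass m → β} (hf : Compatible (fullClasses (starVerts I c L)) f) :
    ∃ t, ∀ u ∉ fullClasses (starVerts I c L), f u = t := by
  classical
  have hD := h.card_fullClasses_le
  obtain rfl | ⟨k, hk, rfl⟩ : m = 1 ∨ ∃ k, 1 ≤ k ∧ m = k + 1 := by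
    rcases hm.eq_or_lt with hm | hm
    · exact Or.inl hm.symm
    · exact Or.inr ⟨m - 1, by omega, by omega⟩
  · refine exists_forall_eq_of_card_le _ f ?_ hf
    -- Two full classes would use up the single star, which would then contain the twin of its
    -- centre; that twin is neither the centre nor adjacent to it.
    by_contra! hlt
    have hR : classVerts (fullClasses (starVerts I c L)) = starVerts I c L := by
      refine Finset.eq_of_subset_of_card_le (classVerts_fullClasses_subset _) ?_
      rw [card_classVerts]
      have := h.card_starVerts_le
      omega
    obtain ⟨s, hs⟩ : I.Nonempty := Finset.card_pos.1 (by omega)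
    have hcs : c s ∈ starVerts I c L := center_mem hs
    have htw : toTwinClass (twin (c s)) = toTwinClass (c s) := toTwinClass_eq_iff.2 (Or.inr rfl)
    rw [← hR, mem_classVerts, ← htw, ← mem_classVerts, hR] at hcs
    obtain ⟨t, ht, hst⟩ := Finset.mem_biUnion.1 hcs
    obtain rfl := Finset.card_le_one.1 hI s hs t ht
    rcases Finset.mem_insert.1 hst with hst | hst
    · exact twin_ne _ hst
    · have := h.adj s hs _ hst
      rw [htw] at this
      exact this.ne rfl
  · refine exists_forall_eq_of_card_le_two_mul hk _ f (by omega) hf ?_ ?_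
    · intro u hu
      obtain ⟨a, ha, rfl⟩ := notMem_fullClasses.1 hu
      obtain ⟨b, hb, hab⟩ := h.exists_adj_notMem hI ha
      exact ⟨_, notMem_fullClasses.2 ⟨b, hb, rfl⟩, hab⟩
    · intro u _ v _ huv
      exact h.exists_adj_notMem_fullClasses hI hm huv

end IsStarFamily

/-- A structure-cut of `BH_{m+1}` by stars has more than `m` members. -/
theorem lt_encard_of_isStructureCut (hm : 1 ≤ m)
    {F : Set (balancedHypercube (m + 1)).Subgraph}
    (hF : IsStructureCut (balancedHypercube (m + 1)) (completeBipartiteGraph (Fin 1) (Fin 3)) F) :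
    (m : ℕ∞) < F.encard := by
  classical
  by_contra! hle
  obtain ⟨⟨-, hdisj, hcut⟩, hiso⟩ := hF
  have hfin : F.Finite := Set.finite_of_encard_le_coe hle
  obtain ⟨I, rfl⟩ := hfin.exists_finset_coe
  rw [Set.encard_coe_eq_coe_finsetCard, Nat.cast_le] at hle
  choose! c L hcard hadj hverts using fun S hS => exists_star_of_iso (hiso S hS)
  have h : IsStarFamily I c L := by
    refine ⟨hcard, fun s hs l hl => balancedHypercube_adj_iff.1 (hadj s hs l hl), ?_⟩
    intro s hs t ht hst
    by_contra hne
    refine Set.disjoint_left.1 (hdisj hs ht hne) (?_ : c s ∈ s.verts) ?_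
    · rw [hverts s hs]; exact Or.inl rfl
    · rw [hverts t ht, hst]; exact Or.inl rfl
  have hR : ∀ a, a ∈ (subgraphVerts (I : Set (balancedHypercube (m + 1)).Subgraph))ᶜ ↔
      a ∉ starVerts I c L := by
    intro a
    rw [Set.mem_compl_iff, not_iff_not]
    simp only [subgraphVerts, starVerts, Set.mem_iUnion, Finset.mem_biUnion, Finset.mem_insert,
      exists_prop, Finset.mem_coe]
    refine exists_congr fun s => and_congr_right fun hs => ?_
    rw [hverts s hs]
    simp
  generalize (subgraphVerts (I : Set (balancedHypercube (m + 1)).Subgraph))ᶜ = X at hR hcut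
  rcases hcut with hcut | ⟨v, hv⟩
  · refine hcut fun u v => ?_
    -- Reachability from `u` seen on classes: adjacency ignores which twin is used, so `f` is
    -- compatible.
    let f : TwinClass m → Prop := fun w =>
      ∃ a : X, toTwinClass a.1 = w ∧ ((balancedHypercube (m + 1)).induce X).Reachable u a
    have key : ∀ w w', Adj w w' → w' ∉ fullClasses (starVerts I c L) → f w → f w' := by
      rintro _ w' hww' hw' ⟨a, rfl, ha⟩
      obtain ⟨b, hb, rfl⟩ := notMem_fullClasses.1 hw'
      exact ⟨⟨b, (hR b).2 hb⟩, rfl, ha.trans (SimpleGraph.Adj.reachable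
        (SimpleGraph.induce_adj.2 (balancedHypercube_adj_iff.2 hww')))⟩
    obtain ⟨t, ht⟩ := h.exists_forall_eq hle hm (f := f) fun w w' hww' hw hw' =>
      propext ⟨key w w' hww' hw', key w' w hww'.symm hw⟩
    have hnot : ∀ a : X, toTwinClass a.1 ∉ fullClasses (starVerts I c L) := fun a =>
      notMem_fullClasses.2 ⟨a, (hR a).1 a.2, rfl⟩
    obtain ⟨a, hav, ha⟩ : f (toTwinClass v.1) := by
      rw [ht _ (hnot v), ← ht _ (hnot u)]
      exact ⟨u, rfl, SimpleGraph.Reachable.refl u⟩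
    -- The vertex `a` reached may be the twin of `v`; a surviving neighbour of `v` is adjacent to
    -- both.
    obtain ⟨b, hb, hvb⟩ := h.exists_adj_notMem hle ((hR v).1 v.2)
    have hab : ((balancedHypercube (m + 1)).induce X).Adj a ⟨b, (hR b).2 hb⟩ :=
      SimpleGraph.induce_adj.2 (balancedHypercube_adj_iff.2 (by rwa [hav]))
    have hvb' : ((balancedHypercube (m + 1)).induce X).Adj v ⟨b, (hR b).2 hb⟩ :=
      SimpleGraph.induce_adj.2 (balancedHypercube_adj_iff.2 hvb)
    exact ha.trans (hab.reachable.trans hvb'.reachable.symm)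
  · subst hv
    obtain ⟨b, hb, hvb⟩ := h.exists_adj_notMem hle ((hR v).1 rfl)
    obtain rfl : b = v := (hR b).2 hb
    exact hvb.ne rfl

end Lower

theorem mainTheorem7 (n : ℕ) [NeZero n] (hn : 2 ≤ n) :
    structureConnectivity (balancedHypercube n) (completeBipartiteGraph (Fin 1) (Fin 3)) = n := by
  refine le_antisymm (sInf_le (exists_isStructureCut hn)) (le_sInf ?_)
  rintro _ ⟨F, hF, rfl⟩
  obtain ⟨m, rfl⟩ : ∃ m, n = m + 1 := ⟨n - 1, by omega⟩
  have := lt_encard_of_isStructureCut (by omega) hF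
  rw [Nat.cast_add, Nat.cast_one]
  exact Order.add_one_le_of_lt this
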